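/- **Theorem 1 (Mercer's Theorem for Operator-Valued Kernels).** Let $\mathbb{H}$ be a separable real Hilbert space. For a bounded operator $B$ on $\mathbb{H}$ let $\|B\|_{1}=\operatorname{tr}\sqrt{B^*B}\in[0,\infty]$ be its trace norm, call $B$ trace-class if $\|B\|_1<\infty$, and for $u,v\in\mathbb{H}$ let $u\otimes v$ be the operator $(u\otimes v)h=\langle u,h\rangle v$. Let $\mathcal{T}$ be a compact subset of a Euclidean space $\mathbb{R}^d$, equipped with Lebesgue measure, such that every neighbourhood of every point of $\mathcal{T}$ meets $\mathcal{T}$ in a set of positive Lebesgue measure. Let $K$ be a map from $\mathcal{T}\times\mathcal{T}$ to the trace-class operators on $\mathbb{H}$ that is - continuous in trace norm: $\|K(s,t)-K(s',t')\|_1\to 0$ as $(s',t')\to(s,t)$, for all $s,t\in\mathcal{T}$; - symmetric: $K(s,t)=K(t,s)^*$ for all $s,t\in\mathcal{T}$; - non-negative definite: $\sum_{i,j=1}^n\langle K(v_i,v_j)h_i,h_j\rangle\ge 0$ for all $n\geq 1$, $v_1,\dots,v_n\in\mathcal{T}$ and $h_1,\dots,h_n\in\mathbb{H}$. Let $\mathcal{A}_K$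 be the integral operator on $L^2(\mathcal{T},\mathbb{H})$ given by the Bochner integral $(\mathcal{A}_Kf)(t)=\int_{\mathcal{T}}K(s,t)f(s)\,ds$, and let $(\lambda_j,\Phi_j)_{j}$ be its eigenvalue and eigenfunction pairs: the $\Phi_j\in L^2(\mathcal{T},\mathbb{H})$ are orthonormal, $\lambda_j\in\mathbb{R}$, $\mathcal{A}_K\Phi_j=\lambda_j\Phi_j$, and for every $\lambda\neq0$ the closed linear span of the $\Phi_j$ with $\lambda_j=\lambda$ contains every $f\in L^2(\mathcal{T},\mathbb{H})$ with $\mathcal{A}_Kf=\lambda f$ (eigenfunctions with eigenvalue $0$ may or may not be included in the family). Then every $\Phi_j$ with $\lambda_j\ne0$ has a continuous representative, again denoted $\Phi_j$, and with these representatives (the terms with $\lambda_j=0$ vanish) $$K(s,t)=\sum_{j}\lambda_j\,\Phi_j(s)\otimes\Phi_j(t)\qquad\text{for all } s,t\in\mathcal{T}.$$ The series converges absolutely and uniformly in trace norm: $\sum_j\|\lambda_j\Phi_j(s)\otimes\Phi_j(t)\|_1<\infty$ for all $s,t$; this series of norms converges uniformly on $\mathcal{T}\times\mathcal{T}$; and,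 along the directed set of finite sets $F$ of indices, $$\lim_{F}\ \sup_{s,t\in\mathcal{T}}\Big\|K(s,t)-\sum_{j\in F}\lambda_j\,\Phi_j(s)\otimes\Phi_j(t)\Big\|_1=0 .$$ -/

import Mathlib

open MeasureTheory Filter Topology
open scoped ENNReal InnerProductSpace

namespace OperatorMercer

noncomputable section

/-- Lebesgue measure on a subset `T` of a Euclidean space, as a measure on the subtype. -/
def lebesgueOn {d : ℕ} (T : Set (EuclideanSpace ℝ (Fin d))) : Measure T :=
  Measure.comap (Subtype.val : T → EuclideanSpace ℝ (Fin d)) volume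

section Operators

variable {H : Type*} [NormedAddCommGroup H] [InnerProductSpace ℝ H]

/-- The rank-one operator `u ⊗ v`, acting by `(u ⊗ v) h = ⟨u, h⟩ v`. -/
def tensor (u v : H) : H →L[ℝ] H := (innerSL ℝ u).smulRight v

variable [CompleteSpace H]

/-- The index set of a fixed complete orthonormal system of `H`. -/
def cons (H : Type*) [NormedAddCommGroup H] [InnerProductSpace ℝ H] [CompleteSpace H] : Set H :=
  (exists_hilbertBasis ℝ H).choose

/-- A fixed complete orthonormal system of `H`. -/
def consBasis (H : Type*) [NormedAddCommGroup H] [InnerProductSpace ℝ H] [CompleteSpace H] :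
    HilbertBasis (cons H) ℝ H :=
  (exists_hilbertBasis ℝ H).choose_spec.choose

/-- The trace `∑ᵢ ⟨S eᵢ, eᵢ⟩ ∈ [0, ∞]` of a positive operator `S`
(independent of the complete orthonormal system `e`). -/
def posTrace (S : H →L[ℝ] H) : ℝ≥0∞ :=
  ∑' i : cons H, ENNReal.ofReal ⟪S (consBasis H i), consBasis H i⟫_ℝ

/-- `S` is the operator absolute value `√(B* B)`: the (unique) positive operator
whose square is `B* B`. -/
def IsSqrtAdjointMul (B S : H →L[ℝ] H) : Prop :=
  S.IsPositive ∧ S ∘L S = ContinuousLinearMap.adjoint B ∘L B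

/-- The trace norm `‖B‖₁ = tr √(B* B) ∈ [0, ∞]`. Exactly one operator `S` satisfies
`IsSqrtAdjointMul B S`, so the infimum below ranges over the single value `tr √(B* B)`. -/
def traceNorm (B : H →L[ℝ] H) : ℝ≥0∞ :=
  ⨅ (S : H →L[ℝ] H) (_ : IsSqrtAdjointMul B S), posTrace S

/-- `B` is trace-class: `‖B‖₁ < ∞`. -/
def IsTraceClass (B : H →L[ℝ] H) : Prop := traceNorm B < ∞

end Operators

section Kernels

variable {X : Type*} {H : Type*} [NormedAddCommGroup H] [InnerProductSpace ℝ H] [CompleteSpace H]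

/-- Continuity of an operator-valued kernel with respect to the trace norm. -/
def IsTraceContinuous [TopologicalSpace X] (K : X → X → H →L[ℝ] H) : Prop :=
  ∀ s t : X, Tendsto (fun p : X × X => traceNorm (K s t - K p.1 p.2)) (𝓝 (s, t)) (𝓝 0)

/-- Symmetry: `K(s,t) = K(t,s)*`. -/
def IsSymmKernel (K : X → X → H →L[ℝ] H) : Prop :=
  ∀ s t : X, K s t = ContinuousLinearMap.adjoint (K t s)

/-- Non-negative definiteness. -/
def IsNonnegDef (K : X → X → H →L[ℝ] H) : Prop :=
  ∀ (n : ℕ) (v : Fin n → X) (h : Fin n → H),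
    0 ≤ ∑ i, ∑ j, ⟪K (v i) (v j) (h i), h j⟫_ℝ

variable [MeasurableSpace X]

/-- The integral operator `(A_K f)(t) = ∫ K(s,t) f(s) dμ(s)` (Bochner integral). -/
def integralOperator (μ : Measure X) (K : X → X → H →L[ℝ] H) (f : X → H) (t : X) : H :=
  ∫ s, K s t (f s) ∂μ

/-- `A_K f = c f` in `L²(μ, H)`. -/
def IsEigenEq (μ : Measure X) (K : X → X → H →L[ℝ] H) (c : ℝ) (f : Lp H 2 μ) : Prop :=
  integralOperator μ K f =ᵐ[μ] fun t => c • f t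

/-- `(lam j, Φ j)` are the eigenvalue-eigenfunction pairs of `A_K`: an orthonormal family in
`L²(μ, H)` of eigenfunctions that exhausts the eigenspace of every nonzero eigenvalue (each
nonzero eigenvalue being repeated according to its multiplicity). The family may or may not
contain eigenfunctions of the eigenvalue `0`. -/
structure IsEigensystem {ι : Type*} (μ : Measure X) (K : X → X → H →L[ℝ] H)
    (lam : ι → ℝ) (Φ : ι → Lp H 2 μ) : Prop where
  orthonormal : Orthonormal ℝ Φ
  eigen : ∀ j, IsEigenEq μ K (lam j) (Φ j)
  exhaust : ∀ c : ℝ, c ≠ 0 → ∀ f : Lp H 2 μ, IsEigenEq μ K c f →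
    f ∈ (Submodule.span ℝ (Φ '' {j | lam j = c})).topologicalClosure

end Kernels

end

end OperatorMercer

/-! Factor the kernel as K(s,t) = V(t)* V(s) with V(t) : H → W, where no nonzero w ∈ W is killed by
every V(t)* (`exists_featureMap`). Let J : W → L² send w to t ↦ V(t)* w. Then A_K = J J*
(`integralOperator_eq`), so λ_j = ‖J*Φ_j‖² ≥ 0, and for λ_j ≠ 0 the vectors ψ_j = λ_j^(-1/2) J*Φ_j
are orthonormal in W. They are complete: J is Hilbert–Schmidt, so the spectral theorem for compact
self-adjoint operators applies to J J*, and J is injective because the measure has full support.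

Put φ_j(t) = λ_j⁻¹ V(t)* J*Φ_j, which is continuous and satisfies V(t)* ψ_j = √λ_j φ_j(t). Parseval
in the basis ψ gives ∑ λ_j ‖φ_j(t)‖² = ‖V(t)‖²_HS = tr K(t,t). The right side is finite and
continuous in t by the trace-norm hypotheses, so Dini's theorem makes the tails uniformly small.

The remainder of the Mercer series is V(t)* D_F V(s), with D_F the projection off the ψ_j with j ∈
F. Since ‖B* A‖₁ ≤ ‖A‖²_HS + ‖B‖²_HS, its trace norm is at most the tail at s plus the tail at t.
The series of norms has the same bound. -/

namespace OperatorMercer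

/-! ### Power series of the square root -/

/-- The Taylor coefficients of `(1 - √(1 - x)) / x`. -/
noncomputable def sqrtCoeff (n : ℕ) : ℝ := catalan n / (2 * 4 ^ n)

theorem sqrtCoeff_nonneg (n : ℕ) : 0 ≤ sqrtCoeff n := by
  unfold sqrtCoeff; positivity

theorem sqrtCoeff_zero : sqrtCoeff 0 = 1 / 2 := by
  simp [sqrtCoeff]

/-- The Catalan recurrence. For g(x) = ∑ `sqrtCoeff n` xⁿ it says x g² = 2g − 1, hence (1 − x g)² =
1 − x. -/
theorem sqrtCoeff_succ (n : ℕ) :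
    2 * sqrtCoeff (n + 1) =
      ∑ p ∈ Finset.HasAntidiagonal.antidiagonal n, sqrtCoeff p.1 * sqrtCoeff p.2 := by
  have h : ∀ p ∈ Finset.HasAntidiagonal.antidiagonal n,
      sqrtCoeff p.1 * sqrtCoeff p.2 = (catalan p.1 * catalan p.2 : ℝ) / (4 * 4 ^ n) := by
    intro p hp
    rw [← Finset.HasAntidiagonal.mem_antidiagonal.mp hp, sqrtCoeff, sqrtCoeff, pow_add]
    field_simp
    ring
  rw [Finset.sum_congr rfl h, ← Finset.sum_div, sqrtCoeff, catalan_succ']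
  push_cast
  field_simp
  ring

/-- The closed form bounds the partial sums by 1, so the series converges on the whole closed unit
ball. The boundary is needed, since ‖1 − A‖ may equal 1. -/
theorem sum_sqrtCoeff (N : ℕ) :
    ∑ n ∈ Finset.range N, sqrtCoeff n = 1 - (N.centralBinom : ℝ) / 4 ^ N := by
  induction N with
  | zero => simp
  | succ N ih =>
    have h1 : ((N : ℝ) + 1) * catalan N = N.centralBinom := by
      exact_mod_cast succ_mul_catalan_eq_centralBinom N
    have h2 : ((N : ℝ) + 1) * (N + 1).centralBinom = 2 * (2 * N + 1) * N.centralBinom := by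
      exact_mod_cast Nat.succ_mul_centralBinom_succ N
    have h3 : (catalan N : ℝ) = N.centralBinom / (N + 1) := by
      rw [← h1]; field_simp
    have h4 : ((N + 1).centralBinom : ℝ) = 2 * (2 * N + 1) * N.centralBinom / (N + 1) := by
      rw [← h2]; field_simp
    rw [Finset.sum_range_succ, ih, sqrtCoeff, h3, h4]
    field_simp
    ring

theorem sum_sqrtCoeff_le_one (N : ℕ) : ∑ n ∈ Finset.range N, sqrtCoeff n ≤ 1 := by
  rw [sum_sqrtCoeff]
  have : (0 : ℝ) ≤ (N.centralBinom : ℝ) / 4 ^ N := by positivity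
  linarith

theorem summable_sqrtCoeff : Summable sqrtCoeff :=
  summable_of_sum_range_le sqrtCoeff_nonneg sum_sqrtCoeff_le_one

theorem tsum_sqrtCoeff_le_one : ∑' n, sqrtCoeff n ≤ 1 :=
  Real.tsum_le_of_sum_range_le sqrtCoeff_nonneg sum_sqrtCoeff_le_one

section BanachAlgebra

variable {A : Type*} [NormedRing A] [NormOneClass A] [NormedAlgebra ℝ A]

theorem norm_sqrtCoeff_smul_pow_le {x : A} (hx : ‖x‖ ≤ 1) (n : ℕ) :
    ‖sqrtCoeff n • x ^ n‖ ≤ sqrtCoeff n := by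
  rw [norm_smul, Real.norm_of_nonneg (sqrtCoeff_nonneg n)]
  exact mul_le_of_le_one_right (sqrtCoeff_nonneg n)
    ((norm_pow_le x n).trans (pow_le_one₀ (norm_nonneg x) hx))

theorem summable_norm_sqrtCoeff_smul_pow {x : A} (hx : ‖x‖ ≤ 1) :
    Summable fun n => ‖sqrtCoeff n • x ^ n‖ :=
  summable_sqrtCoeff.of_nonneg_of_le (fun _ => norm_nonneg _) (norm_sqrtCoeff_smul_pow_le hx)

theorem norm_tsum_sqrtCoeff_le {x : A} (hx : ‖x‖ ≤ 1) :
    ‖∑' n, sqrtCoeff n • x ^ n‖ ≤ 1 :=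
  (tsum_of_norm_bounded summable_sqrtCoeff.hasSum (norm_sqrtCoeff_smul_pow_le hx)).trans
    tsum_sqrtCoeff_le_one

variable [CompleteSpace A]

theorem sq_one_sub_mul_tsum_sqrtCoeff {x : A} (hx : ‖x‖ ≤ 1) :
    (1 - x * ∑' n, sqrtCoeff n • x ^ n) * (1 - x * ∑' n, sqrtCoeff n • x ^ n) = 1 - x := by
  have hs := summable_norm_sqrtCoeff_smul_pow hx
  set g := ∑' n, sqrtCoeff n • x ^ n with hg
  have hcomm : Commute x g :=
    (Commute.tsum_right x fun n => ((Commute.refl x).pow_right n).smul_right _)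
  have hgg : g * g = ∑' n, (2 * sqrtCoeff (n + 1)) • x ^ n := by
    rw [hg, tsum_mul_tsum_eq_tsum_sum_antidiagonal_of_summable_norm hs hs]
    congr 1
    ext n
    rw [sqrtCoeff_succ, Finset.sum_smul]
    refine Finset.sum_congr rfl fun p hp => ?_
    rw [smul_mul_smul_comm, ← pow_add, Finset.HasAntidiagonal.mem_antidiagonal.mp hp]
  have hsum1 : Summable fun n => sqrtCoeff (n + 1) • x ^ n := by
    refine Summable.of_norm_bounded ((summable_nat_add_iff 1).mpr summable_sqrtCoeff) fun n => ?_
    rw [norm_smul, Real.norm_of_nonneg (sqrtCoeff_nonneg _)]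
    exact mul_le_of_le_one_right (sqrtCoeff_nonneg _)
      ((norm_pow_le x n).trans (pow_le_one₀ (norm_nonneg x) hx))
  have hxgg : x * (g * g) = (2 : ℝ) • g - 1 := by
    have h2 : g = (1 / 2 : ℝ) • (1 : A) + ∑' n, sqrtCoeff (n + 1) • x ^ (n + 1) := by
      rw [hg, hs.of_norm.tsum_eq_zero_add, sqrtCoeff_zero, pow_zero]
    have h3 : x * (g * g) = (2 : ℝ) • ∑' n, sqrtCoeff (n + 1) • x ^ (n + 1) := by
      rw [hgg]
      simp_rw [mul_smul]
      rw [tsum_const_smul'' (2 : ℝ), mul_smul_comm, ← hsum1.tsum_mul_left]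
      congr 2
      ext n
      rw [mul_smul_comm, pow_succ']
    rw [h3]
    conv_rhs => rw [h2]
    rw [smul_add, smul_smul]
    norm_num
  have : x * g * (x * g) = x * (x * (g * g)) := by
    rw [mul_assoc, ← mul_assoc g x g, ← hcomm.eq, mul_assoc x g g]
  calc (1 - x * g) * (1 - x * g) = 1 - x * g - x * g + x * g * (x * g) := by noncomm_ring
    _ = 1 - x := by
      rw [this, hxgg, mul_sub, mul_smul_comm, two_smul, mul_one]
      abel

end BanachAlgebra

/-! ### Positive square roots and contraction factorizations -/

section Operators

variable {H : Type*} [NormedAddCommGroup H] [InnerProductSpace ℝ H] [CompleteSpace H]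

omit [CompleteSpace H] in
-- Positivity of A at x − Ax gives ‖Ax‖² ≤ ⟪Ax, x⟫, and then ‖x − Ax‖² = ‖x‖² − 2⟪Ax, x⟫ + ‖Ax‖² ≤
-- ‖x‖².
theorem norm_one_sub_le_one_of_isPositive {A : H →L[ℝ] H} (hA : A.IsPositive) (h1 : ‖A‖ ≤ 1) :
    ‖1 - A‖ ≤ 1 := by
  refine ContinuousLinearMap.opNorm_le_bound _ zero_le_one fun x => ?_
  have hsymm : ∀ u v, ⟪A u, v⟫_ℝ = ⟪u, A v⟫_ℝ := fun u v => hA.isSymmetric u v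
  have h2 : ‖A (A x)‖ ≤ ‖A x‖ := A.le_of_opNorm_le_of_le h1 le_rfl |>.trans (by simp)
  have h3 : ⟪A (A x), A x⟫_ℝ ≤ ‖A x‖ ^ 2 :=
    (real_inner_le_norm _ _).trans (by nlinarith [norm_nonneg (A x)])
  have h4 : 0 ≤ ⟪A (x - A x), x - A x⟫_ℝ := hA.inner_nonneg_left _
  have h5 : ⟪A (x - A x), x - A x⟫_ℝ = ⟪A x, x⟫_ℝ - 2 * ‖A x‖ ^ 2 + ⟪A (A x), A x⟫_ℝ := by
    rw [map_sub, inner_sub_left, inner_sub_right, inner_sub_right, real_inner_self_eq_norm_sq,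
      hsymm (A x) x, real_inner_self_eq_norm_sq]
    ring
  have h6 : ‖(1 - A) x‖ ^ 2 ≤ ‖x‖ ^ 2 := by
    have : (1 - A) x = x - A x := rfl
    rw [this, norm_sub_sq_real, real_inner_comm]
    nlinarith
  simpa using (sq_le_sq₀ (norm_nonneg _) (norm_nonneg _)).mp h6

/-- With X = 1 − A the root is 1 − X g(X). It is self-adjoint as a real power series in X, and
positive because ‖X g(X)‖ ≤ 1. -/
theorem exists_isPositive_sqrt_of_norm_le_one {A : H →L[ℝ] H} (hA : A.IsPositive)
    (h1 : ‖A‖ ≤ 1) : ∃ S : H →L[ℝ] H, S.IsPositive ∧ S ∘L S = A := by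
  -- The Banach algebra lemmas need ‖1‖ = 1, which fails for H = 0.
  rcases subsingleton_or_nontrivial H with _ | _
  · exact ⟨0, ContinuousLinearMap.isPositive_zero, Subsingleton.elim _ _⟩
  set X : H →L[ℝ] H := 1 - A with hX
  have hX1 : ‖X‖ ≤ 1 := norm_one_sub_le_one_of_isPositive hA h1
  set g : H →L[ℝ] H := ∑' n, sqrtCoeff n • X ^ n with hg
  have hXsa : IsSelfAdjoint X := (IsSelfAdjoint.one _).sub hA.isSelfAdjoint
  have hgsa : IsSelfAdjoint g := by
    rw [IsSelfAdjoint, hg, tsum_star]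
    congr 1
    ext1 n
    rw [star_smul, star_pow, hXsa.star_eq]
    simp
  have hcomm : Commute X g :=
    (Commute.tsum_right X fun n => ((Commute.refl X).pow_right n).smul_right _)
  have hXg : IsSelfAdjoint (X * g) := (hXsa.commute_iff hgsa).mp hcomm
  have hnorm : ‖X * g‖ ≤ 1 :=
    (norm_mul_le _ _).trans (mul_le_one₀ hX1 (norm_nonneg _) (norm_tsum_sqrtCoeff_le hX1))
  refine ⟨1 - X * g, ?_, ?_⟩
  · rw [ContinuousLinearMap.isPositive_def']
    refine ⟨(IsSelfAdjoint.one _).sub hXg, fun x => ?_⟩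
    have h2 : ⟪(X * g) x, x⟫_ℝ ≤ ‖x‖ * ‖x‖ :=
      (real_inner_le_norm _ _).trans (mul_le_mul_of_nonneg_right
        (((X * g).le_of_opNorm_le hnorm x).trans (by simp)) (norm_nonneg _))
    have h3 : (1 - X * g) x = x - (X * g) x := rfl
    rw [ContinuousLinearMap.reApplyInnerSelf_apply, h3, inner_sub_left,
      real_inner_self_eq_norm_mul_norm]
    simpa using h2
  · have := sq_one_sub_mul_tsum_sqrtCoeff hX1
    rw [← hg] at this
    have h4 : 1 - X = A := by rw [hX]; abel
    rw [h4] at this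
    exact this

/-- Every positive operator on a real Hilbert space has a positive square root. -/
theorem exists_isPositive_sqrt {A : H →L[ℝ] H} (hA : A.IsPositive) :
    ∃ S : H →L[ℝ] H, S.IsPositive ∧ S ∘L S = A := by
  rcases eq_or_ne A 0 with rfl | h0
  · exact ⟨0, ContinuousLinearMap.isPositive_zero, by simp⟩
  have hpos : 0 < ‖A‖ := norm_pos_iff.mpr h0
  obtain ⟨S, hS, hSS⟩ := exists_isPositive_sqrt_of_norm_le_one
    (A := ‖A‖⁻¹ • A) (hA.smul_of_nonneg (by positivity))
    (by rw [norm_smul, norm_inv, norm_norm, inv_mul_cancel₀ hpos.ne'])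
  refine ⟨√‖A‖ • S, hS.smul_of_nonneg (by positivity), ?_⟩
  rw [ContinuousLinearMap.smul_comp, ContinuousLinearMap.comp_smul, hSS, smul_smul, smul_smul,
    Real.mul_self_sqrt hpos.le, mul_inv_cancel₀ hpos.ne', one_smul]

omit [CompleteSpace H] in
/-- Douglas' factorization: an operator dominated in norm by `B` is a contraction after `B`. -/
theorem exists_contraction_comp_eq {G : Type*} [NormedAddCommGroup G] [InnerProductSpace ℝ G]
    [CompleteSpace G] {B S : H →L[ℝ] G} (h : ∀ x, ‖S x‖ ≤ ‖B x‖) :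
    ∃ C : G →L[ℝ] G, ‖C‖ ≤ 1 ∧ S = C ∘L B := by
  set R : Submodule ℝ G := (LinearMap.range B.toLinearMap).topologicalClosure with hR
  have hmem : ∀ x, B.toLinearMap x ∈ R := fun x =>
    Submodule.le_topologicalClosure _ (LinearMap.mem_range_self _ x)
  set e : H →ₗ[ℝ] R := B.toLinearMap.codRestrict R hmem with he
  have hdense : DenseRange e := by
    intro y
    rw [Metric.mem_closure_iff]
    intro ε hε
    obtain ⟨z, ⟨x, rfl⟩, hz⟩ := Metric.mem_closure_iff.mp y.2 ε hε
    exact ⟨e x, ⟨x, rfl⟩, hz⟩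
  have hbd : ∀ x, ‖S.toLinearMap x‖ ≤ 1 * ‖e x‖ := fun x => by
    rw [one_mul]; exact h x
  have : CompleteSpace R := (Submodule.isClosed_topologicalClosure _).completeSpace_coe
  -- The map B x ↦ S x is a contraction on the range of B. It extends to the closure, and the
  -- orthogonal projection carries it to all of G.
  refine ⟨(S.toLinearMap.extendOfNorm e) ∘L R.orthogonalProjectionOnto, ?_, ?_⟩
  · refine (ContinuousLinearMap.opNorm_comp_le _ _).trans (mul_le_one₀
      (LinearMap.opNorm_extendOfNorm_le hdense zero_le_one hbd) (norm_nonneg _)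
      (R.orthogonalProjectionOnto_norm_le))
  · ext x
    have h1 : R.orthogonalProjectionOnto (B x) = e x :=
      Submodule.orthogonalProjectionOnto_mem_subspace_eq_self (e x)
    rw [ContinuousLinearMap.comp_apply, ContinuousLinearMap.comp_apply, h1,
      LinearMap.extendOfNorm_eq hdense ⟨1, hbd⟩]
    rfl

end Operators

/-! ### Hilbert–Schmidt norms -/

section HilbertSchmidt

variable {E F : Type*} [NormedAddCommGroup E] [InnerProductSpace ℝ E]
  [NormedAddCommGroup F] [InnerProductSpace ℝ F]
  {ι κ : Type*}

/-- The squared Hilbert–Schmidt norm `∑ᵢ ‖V bᵢ‖²` computed in the Hilbert basis `b`. -/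
noncomputable def hsSq (b : HilbertBasis ι ℝ E) (V : E →L[ℝ] F) : ℝ≥0∞ :=
  ∑' i, ENNReal.ofReal (‖V (b i)‖ ^ 2)

theorem ofReal_norm_sq_eq_tsum (b : HilbertBasis ι ℝ E) (x : E) :
    ENNReal.ofReal (‖x‖ ^ 2) = ∑' i, ENNReal.ofReal (⟪b i, x⟫_ℝ ^ 2) := by
  have h := b.hasSum_inner_mul_inner x x
  have h2 : (fun i => ⟪x, b i⟫_ℝ * ⟪b i, x⟫_ℝ) = fun i => ⟪b i, x⟫_ℝ ^ 2 := by
    ext i; rw [real_inner_comm, sq]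
  rw [h2, real_inner_self_eq_norm_sq] at h
  rw [← ENNReal.ofReal_tsum_of_nonneg (fun _ => sq_nonneg _) h.summable, h.tsum_eq]

theorem hsSq_mono {G : Type*} [NormedAddCommGroup G] [InnerProductSpace ℝ G]
    (b : HilbertBasis ι ℝ E) {V : E →L[ℝ] F} {V' : E →L[ℝ] G}
    (h : ∀ x, ‖V x‖ ≤ ‖V' x‖) : hsSq b V ≤ hsSq b V' :=
  ENNReal.tsum_le_tsum fun i => ENNReal.ofReal_le_ofReal (by gcongr; exact h _)

/-- A Hilbert–Schmidt operator is compact. -/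
theorem isCompactOperator_of_hsSq_ne_top [CompleteSpace F]
    (b : HilbertBasis ι ℝ E) (V : E →L[ℝ] F) (h : hsSq b V ≠ ∞) : IsCompactOperator V := by
  have hs : Summable fun i => ‖V (b i)‖ ^ 2 := by
    have := ENNReal.summable_toReal h
    refine this.congr fun i => ?_
    rw [ENNReal.toReal_ofReal (by positivity)]
  set R : ι → E →L[ℝ] F := fun i => (innerSL ℝ (b i)).smulRight (V (b i)) with hR
  have hRc : ∀ i, IsCompactOperator (R i) := fun i => by
    have h1 : IsCompactOperator (ContinuousLinearMap.toSpanSingleton ℝ (V (b i))) := by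
      have : IsCompactOperator (ContinuousLinearMap.id ℝ ℝ) := by
        refine ⟨Metric.closedBall 0 1, isCompact_closedBall _ _, ?_⟩
        exact Metric.closedBall_mem_nhds _ one_pos
      exact this.clm_comp (ContinuousLinearMap.toSpanSingleton ℝ (V (b i)))
    exact h1.comp_clm (innerSL ℝ (b i))
  -- Cauchy–Schwarz and Bessel. This makes the rank-one series converge unconditionally in operator
  -- norm, although it need not converge absolutely.
  have hbound : ∀ G : Finset ι, ‖∑ i ∈ G, R i‖ ≤ √(∑ i ∈ G, ‖V (b i)‖ ^ 2) := fun G => by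
    refine ContinuousLinearMap.opNorm_le_bound _ (Real.sqrt_nonneg _) fun x => ?_
    rw [FunLike.coe_sum, Finset.sum_apply]
    calc ‖∑ i ∈ G, R i x‖ ≤ ∑ i ∈ G, ‖V (b i)‖ * |⟪b i, x⟫_ℝ| := by
          refine (norm_sum_le _ _).trans (Finset.sum_le_sum fun i _ => ?_)
          simp [hR, norm_smul, mul_comm]
      _ ≤ √(∑ i ∈ G, ‖V (b i)‖ ^ 2) * √(∑ i ∈ G, |⟪b i, x⟫_ℝ| ^ 2) :=
          Real.sum_mul_le_sqrt_mul_sqrt _ _ _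
      _ ≤ √(∑ i ∈ G, ‖V (b i)‖ ^ 2) * ‖x‖ := by
          gcongr
          refine Real.sqrt_le_iff.mpr ⟨norm_nonneg _, ?_⟩
          simpa using b.orthonormal.sum_inner_products_le x (s := G)
  have hsum : Summable R := by
    rw [summable_iff_vanishing_norm]
    intro ε hε
    obtain ⟨s, hs'⟩ := summable_iff_vanishing_norm.mp hs (ε ^ 2) (by positivity)
    refine ⟨s, fun t ht => (hbound t).trans_lt ?_⟩
    rw [Real.sqrt_lt' hε]
    exact (le_abs_self _).trans_lt (hs' t ht)
  have hV : HasSum R V := by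
    convert hsum.hasSum
    ext x
    have h1 : HasSum (fun i => R i x) ((∑' i, R i) x) :=
      hsum.hasSum.mapL (ContinuousLinearMap.apply ℝ F x)
    have h2 : HasSum (fun i => V (b.repr x i • b i)) (V x) := (b.hasSum_repr x).mapL V
    refine h2.unique (h1.congr_fun ?_)
    intro i
    simp [hR, b.repr_apply_apply]
  refine isClosed_setOfPred_isCompactOperator.mem_of_tendsto hV (Eventually.of_forall fun G => ?_)
  exact (compactOperator (RingHom.id ℝ) E F).sum_mem fun i _ => hRc i

variable [CompleteSpace E] [CompleteSpace F]

/-- Both sides are the double sum of the squared matrix entries. Applied twice, this also gives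
independence of the basis. -/
theorem hsSq_eq_hsSq_adjoint (b : HilbertBasis ι ℝ E) (c : HilbertBasis κ ℝ F)
    (V : E →L[ℝ] F) : hsSq b V = hsSq c (ContinuousLinearMap.adjoint V) := by
  unfold hsSq
  simp_rw [ofReal_norm_sq_eq_tsum c (V _), ofReal_norm_sq_eq_tsum b (ContinuousLinearMap.adjoint V _)]
  rw [ENNReal.tsum_comm]
  simp_rw [ContinuousLinearMap.adjoint_inner_right, real_inner_comm]

theorem ofReal_norm_apply_sq_le (b : HilbertBasis ι ℝ E) (V : E →L[ℝ] F) (x : E) :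
    ENNReal.ofReal (‖V x‖ ^ 2) ≤ ENNReal.ofReal (‖x‖ ^ 2) * hsSq b V := by
  obtain ⟨w, c, -⟩ := exists_hilbertBasis ℝ F
  rw [ofReal_norm_sq_eq_tsum c, hsSq_eq_hsSq_adjoint b c, hsSq, ← ENNReal.tsum_mul_left]
  refine ENNReal.tsum_le_tsum fun j => ?_
  rw [← ENNReal.ofReal_mul (by positivity), ← ContinuousLinearMap.adjoint_inner_left]
  refine ENNReal.ofReal_le_ofReal ?_
  rw [← mul_pow, mul_comm]
  exact sq_le_sq' (neg_le_of_abs_le (abs_real_inner_le_norm _ _)) (real_inner_le_norm _ _)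

end HilbertSchmidt

/-! ### Trace norm estimates -/

section TraceNorm

variable {H : Type*} [NormedAddCommGroup H] [InnerProductSpace ℝ H] [CompleteSpace H]

theorem IsSqrtAdjointMul.norm_apply_eq {B S : H →L[ℝ] H} (h : IsSqrtAdjointMul B S) (x : H) :
    ‖S x‖ = ‖B x‖ := by
  have h1 : ⟪S x, S x⟫_ℝ = ⟪B x, B x⟫_ℝ := by
    have h2 : S (S x) = ContinuousLinearMap.adjoint B (B x) := congrArg (fun A => A x) h.2
    rw [← ContinuousLinearMap.adjoint_inner_left B, ← h2]
    exact (h.1.isSymmetric (S x) x).symm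
  rw [real_inner_self_eq_norm_sq, real_inner_self_eq_norm_sq] at h1
  exact (sq_eq_sq₀ (norm_nonneg _) (norm_nonneg _)).mp h1

theorem exists_isSqrtAdjointMul (B : H →L[ℝ] H) : ∃ S, IsSqrtAdjointMul B S :=
  exists_isPositive_sqrt (ContinuousLinearMap.isPositive_adjoint_comp_self B)

theorem posTrace_comp_self {Q : H →L[ℝ] H} (hQ : Q.IsPositive) :
    posTrace (Q ∘L Q) = hsSq (consBasis H) Q := by
  refine tsum_congr fun i => ?_
  rw [← real_inner_self_eq_norm_sq]
  exact congrArg _ (hQ.isSymmetric _ _)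

/-- The factorization `B = C Q²` with a contraction `C` and a positive operator `Q` whose squared
Hilbert–Schmidt norm is the trace of `√(B* B)`. -/
theorem IsSqrtAdjointMul.exists_factorization {B S : H →L[ℝ] H} (h : IsSqrtAdjointMul B S) :
    ∃ C Q : H →L[ℝ] H, ‖C‖ ≤ 1 ∧ Q.IsPositive ∧ B = C ∘L Q ∘L Q ∧
      posTrace S = hsSq (consBasis H) Q := by
  obtain ⟨C, hC, hBC⟩ := exists_contraction_comp_eq (B := S) (S := B)
    fun x => (h.norm_apply_eq x).ge
  obtain ⟨Q, hQ, hQS⟩ := exists_isPositive_sqrt h.1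
  exact ⟨C, Q, hC, hQ, by rw [hQS, hBC], by rw [← hQS, posTrace_comp_self hQ]⟩

/-- The trace norm dominates the sum of the moduli of the diagonal matrix entries. -/
theorem tsum_abs_inner_le_traceNorm (B : H →L[ℝ] H) :
    ∑' i, ENNReal.ofReal |⟪B (consBasis H i), consBasis H i⟫_ℝ| ≤ traceNorm B := by
  refine le_iInf₂ fun S hS => ?_
  obtain ⟨C, Q, hC, hQ, rfl, hT⟩ := hS.exists_factorization
  rw [hT]
  set e := consBasis H
  -- The diagonal entries become ⟪Q eᵢ, Q C* eᵢ⟫, to which 2ab ≤ a² + b² applies. The adjoint of Q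
  -- C* is C Q, so its Hilbert–Schmidt norm is at most that of Q.
  set Q' := Q ∘L ContinuousLinearMap.adjoint C with hQ'
  have h1 : hsSq e Q' ≤ hsSq e Q := by
    rw [hsSq_eq_hsSq_adjoint e e Q', hQ', ContinuousLinearMap.adjoint_comp,
      ContinuousLinearMap.adjoint_adjoint, hQ.isSelfAdjoint.adjoint_eq]
    refine hsSq_mono e fun x => ?_
    simpa using C.le_of_opNorm_le hC (Q x)
  have h2 : ∀ i, 2 * ENNReal.ofReal |⟪(C ∘L Q ∘L Q) (e i), e i⟫_ℝ|
      ≤ ENNReal.ofReal (‖Q (e i)‖ ^ 2) + ENNReal.ofReal (‖Q' (e i)‖ ^ 2) := fun i => by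
    have h3 : ⟪(C ∘L Q ∘L Q) (e i), e i⟫_ℝ = ⟪Q (e i), Q' (e i)⟫_ℝ := by
      simp only [hQ', ContinuousLinearMap.comp_apply]
      rw [← ContinuousLinearMap.adjoint_inner_right C]
      exact hQ.isSymmetric _ _
    rw [h3, ← ENNReal.ofReal_add (by positivity) (by positivity),
      show (2 : ℝ≥0∞) = ENNReal.ofReal 2 by simp, ← ENNReal.ofReal_mul (by norm_num)]
    refine ENNReal.ofReal_le_ofReal ?_
    nlinarith [abs_real_inner_le_norm (Q (e i)) (Q' (e i)), sq_nonneg (‖Q (e i)‖ - ‖Q' (e i)‖)]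
  have h4 : 2 * ∑' i, ENNReal.ofReal |⟪(C ∘L Q ∘L Q) (e i), e i⟫_ℝ| ≤ 2 * hsSq e Q := by
    rw [← ENNReal.tsum_mul_left, two_mul]
    refine (ENNReal.tsum_le_tsum h2).trans ?_
    rw [ENNReal.tsum_add]
    exact add_le_add le_rfl h1
  exact (ENNReal.mul_le_mul_iff_right (by norm_num) (by norm_num)).mp h4

/-- The trace norm dominates the operator norm. -/
theorem ofReal_norm_le_traceNorm (B : H →L[ℝ] H) : ENNReal.ofReal ‖B‖ ≤ traceNorm B := by
  refine le_iInf₂ fun S hS => ?_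
  obtain ⟨C, Q, hC, hQ, rfl, hT⟩ := hS.exists_factorization
  rw [hT]
  rcases eq_or_ne (hsSq (consBasis H) Q) ∞ with htop | htop
  · simp [htop]
  have h1 : ∀ x, ‖Q x‖ ≤ √(hsSq (consBasis H) Q).toReal * ‖x‖ := fun x => by
    have := ENNReal.toReal_mono (by finiteness) (ofReal_norm_apply_sq_le (consBasis H) Q x)
    rw [ENNReal.toReal_mul, ENNReal.toReal_ofReal (by positivity),
      ENNReal.toReal_ofReal (by positivity)] at this
    rw [← sq_le_sq₀ (by positivity) (by positivity), mul_pow, Real.sq_sqrt (by positivity)]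
    linarith
  have h2 : ‖Q‖ ≤ √(hsSq (consBasis H) Q).toReal :=
    ContinuousLinearMap.opNorm_le_bound _ (by positivity) h1
  refine ENNReal.ofReal_le_of_le_toReal ?_
  calc ‖C ∘L Q ∘L Q‖ ≤ ‖C‖ * (‖Q‖ * ‖Q‖) :=
        (C.opNorm_comp_le _).trans (by gcongr; exact Q.opNorm_comp_le _)
    _ ≤ 1 * (√(hsSq (consBasis H) Q).toReal * √(hsSq (consBasis H) Q).toReal) := by gcongr
    _ = _ := by rw [one_mul, Real.mul_self_sqrt (by positivity)]

/-- The trace norm of a product is at most the sum of the squared Hilbert–Schmidt norms of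
the factors. -/
theorem traceNorm_adjoint_comp_le {W : Type*} [NormedAddCommGroup W] [InnerProductSpace ℝ W]
    [CompleteSpace W] (V₁ V₂ : H →L[ℝ] W) :
    traceNorm (ContinuousLinearMap.adjoint V₂ ∘L V₁) ≤
      hsSq (consBasis H) V₁ + hsSq (consBasis H) V₂ := by
  obtain ⟨S, hS⟩ := exists_isSqrtAdjointMul (ContinuousLinearMap.adjoint V₂ ∘L V₁)
  obtain ⟨C, hC, hSC⟩ := exists_contraction_comp_eq
    (B := ContinuousLinearMap.adjoint V₂ ∘L V₁) (S := S) fun x => (hS.norm_apply_eq x).le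
  refine (iInf₂_le S hS).trans ?_
  set e := consBasis H
  -- Since √(B* B) = C V₂* V₁, its diagonal entries are ⟪V₁ eᵢ, V₂ C* eᵢ⟫.
  set V' := V₂ ∘L ContinuousLinearMap.adjoint C with hV'
  obtain ⟨w, c, -⟩ := exists_hilbertBasis ℝ W
  have h1 : hsSq e V' ≤ hsSq e V₂ := by
    rw [hsSq_eq_hsSq_adjoint e c V', hsSq_eq_hsSq_adjoint e c V₂, hV',
      ContinuousLinearMap.adjoint_comp, ContinuousLinearMap.adjoint_adjoint]
    refine hsSq_mono c fun x => ?_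
    simpa using C.le_of_opNorm_le hC (ContinuousLinearMap.adjoint V₂ x)
  refine le_trans ?_ (add_le_add le_rfl h1)
  rw [hsSq, hsSq, ← ENNReal.tsum_add]
  refine ENNReal.tsum_le_tsum fun i => ?_
  have h3 : ⟪S (e i), e i⟫_ℝ = ⟪V₁ (e i), V' (e i)⟫_ℝ := by
    rw [hSC]
    simp only [hV', ContinuousLinearMap.comp_apply]
    rw [← ContinuousLinearMap.adjoint_inner_right C, ContinuousLinearMap.adjoint_inner_left]
  rw [h3, ← ENNReal.ofReal_add (by positivity) (by positivity)]
  refine ENNReal.ofReal_le_ofReal ?_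
  nlinarith [real_inner_le_norm (V₁ (e i)) (V' (e i)), sq_nonneg (‖V₁ (e i)‖ - ‖V' (e i)‖),
    sq_nonneg (‖V₁ (e i)‖), sq_nonneg (‖V' (e i)‖)]

theorem traceNorm_tensor_le (u v : H) :
    traceNorm (tensor u v) ≤ ENNReal.ofReal (‖u‖ ^ 2) + ENNReal.ofReal (‖v‖ ^ 2) := by
  have h1 : tensor u v = ContinuousLinearMap.adjoint (innerSL ℝ v) ∘L innerSL ℝ u := by
    ext x
    refine ext_inner_right ℝ fun y => ?_
    rw [ContinuousLinearMap.comp_apply, ContinuousLinearMap.adjoint_inner_left]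
    simp [tensor, real_inner_smul_left, mul_comm]
  have h2 : ∀ w : H, hsSq (consBasis H) (innerSL ℝ w) = ENNReal.ofReal (‖w‖ ^ 2) := fun w => by
    rw [ofReal_norm_sq_eq_tsum (consBasis H)]
    refine tsum_congr fun i => ?_
    rw [innerSL_apply_apply, Real.norm_eq_abs, sq_abs, real_inner_comm]
  rw [h1, ← h2, ← h2]
  exact traceNorm_adjoint_comp_le _ _

/-- Giving √c to each factor produces the terms λ ‖φ(s)‖² and λ ‖φ(t)‖² of the two diagonal series.
-/
theorem traceNorm_smul_tensor_le {c : ℝ} (hc : 0 ≤ c) (u v : H) :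
    traceNorm (c • tensor u v) ≤ ENNReal.ofReal (c * ‖u‖ ^ 2) + ENNReal.ofReal (c * ‖v‖ ^ 2) := by
  have h1 : c • tensor u v = tensor (√c • u) (√c • v) := by
    ext x
    simp only [tensor, ContinuousLinearMap.smulRight_apply, FunLike.coe_smul, Pi.smul_apply,
      innerSL_apply_apply, real_inner_smul_left, smul_smul]
    congr 1
    linear_combination (-⟪u, x⟫_ℝ) * Real.mul_self_sqrt hc
  have h2 : ∀ w : H, ‖√c • w‖ ^ 2 = c * ‖w‖ ^ 2 := fun w => by
    rw [norm_smul, mul_pow, Real.norm_eq_abs, sq_abs, Real.sq_sqrt hc]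
  rw [h1, ← h2, ← h2]
  exact traceNorm_tensor_le _ _

end TraceNorm

/-! ### Factorization of the kernel -/

section FeatureMap

universe u v

/-- The Moore–Aronszajn factorization of a non-negative definite operator-valued kernel. -/
theorem exists_featureMap {X : Type u} {H : Type v} [NormedAddCommGroup H]
    [InnerProductSpace ℝ H] [CompleteSpace H] (K : X → X → H →L[ℝ] H)
    (hsymm : IsSymmKernel K) (hnonneg : IsNonnegDef K) :
    ∃ (W : Type (max u v)) (_ : NormedAddCommGroup W) (_ : InnerProductSpace ℝ W)
      (_ : CompleteSpace W) (V : X → H →L[ℝ] W),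
      (∀ s t, K s t = ContinuousLinearMap.adjoint (V t) ∘L V s) ∧
      ∀ w, (∀ t, ContinuousLinearMap.adjoint (V t) w = 0) → w = 0 := by
  -- The arguments are swapped because the reproducing kernel at (t, s) is V(t)* V(s), which has to
  -- equal `K s t`.
  set M : Matrix X X (H →L[ℝ] H) := .of fun x y => K y x with hM
  have hpos : M.PosSemidef := by
    have htfae := (RKHS.posSemidef_tfae (K := M)).out 0 2
    refine htfae.mpr ⟨?_, fun f => ?_⟩
    · ext1 x y
      simp only [Matrix.conjTranspose_apply, hM, Matrix.of_apply]
      exact (hsymm y x).symm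
    · have h := hnonneg f.support.card (fun i => f.support.equivFin.symm i)
        (fun i => f (f.support.equivFin.symm i))
      refine h.trans_eq ?_
      simp only [Finsupp.sum, hM, Matrix.of_apply, RCLike.re_to_real]
      rw [← Finset.sum_coe_sort f.support, ← f.support.equivFin.symm.sum_comp]
      refine Finset.sum_congr rfl fun i _ => ?_
      rw [← Finset.sum_coe_sort f.support, ← f.support.equivFin.symm.sum_comp]
  have : Fact M.PosSemidef := ⟨hpos⟩
  refine ⟨RKHS.OfKernel M, inferInstance, inferInstance, inferInstance,
    RKHS.kerFun (RKHS.OfKernel M), fun s t => ?_, fun w hw => ?_⟩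
  · rw [← RKHS.kernel_apply, RKHS.OfKernel.kernel_ofKernel]
    rfl
  -- An element w of the reproducing kernel space is a function with value V(t)* w at t.
  · refine RKHS.ext fun t => ?_
    rw [← RKHS.adjoint_kerFun, hw t, RKHS.coe_zero, Pi.zero_apply]

end FeatureMap

/-! ### Continuity of the feature map and of the trace on the diagonal -/

section Continuity

variable {X H W : Type*} [TopologicalSpace X] [NormedAddCommGroup H] [InnerProductSpace ℝ H]
  [CompleteSpace H] [NormedAddCommGroup W] [InnerProductSpace ℝ W] [CompleteSpace W]
  {K : X → X → H →L[ℝ] H} {V : X → H →L[ℝ] W}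

theorem IsTraceContinuous.continuous (hK : IsTraceContinuous K) :
    Continuous fun p : X × X => K p.1 p.2 := by
  refine continuous_iff_continuousAt.mpr fun p => ?_
  rw [ContinuousAt, tendsto_iff_norm_sub_tendsto_zero]
  have h1 : Tendsto (fun q : X × X => ENNReal.ofReal ‖K p.1 p.2 - K q.1 q.2‖) (𝓝 p) (𝓝 0) :=
    tendsto_of_tendsto_of_tendsto_of_le_of_le tendsto_const_nhds (hK p.1 p.2)
      (fun _ => zero_le) fun _ => ofReal_norm_le_traceNorm _
  have h2 := (ENNReal.tendsto_toReal ENNReal.zero_ne_top).comp h1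
  refine h2.congr fun q => ?_
  rw [Function.comp_apply, ENNReal.toReal_ofReal (norm_nonneg _), norm_sub_rev]

/-- By the C*-identity, ‖V(t) − V(s)‖² is the norm of the second difference K(t,t) − K(s,t) − K(t,s)
+ K(s,s). -/
theorem continuous_featureMap (hK : Continuous fun p : X × X => K p.1 p.2)
    (hV : ∀ s t, K s t = ContinuousLinearMap.adjoint (V t) ∘L V s) : Continuous V := by
  refine continuous_iff_continuousAt.mpr fun s => ?_
  rw [ContinuousAt, tendsto_iff_norm_sub_tendsto_zero]
  have h1 : ∀ t, ‖V t - V s‖ = √‖K t t - K s t - (K t s - K s s)‖ := fun t => by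
    have h2 : K t t - K s t - (K t s - K s s)
        = ContinuousLinearMap.adjoint (V t - V s) ∘L (V t - V s) := by
      rw [hV t t, hV s t, hV t s, hV s s, map_sub, ContinuousLinearMap.comp_sub,
        ContinuousLinearMap.sub_comp, ContinuousLinearMap.sub_comp]
      abel
    rw [h2, ContinuousLinearMap.norm_adjoint_comp_self, Real.sqrt_mul_self (norm_nonneg _)]
  simp_rw [h1]
  have h3 : Continuous fun t => √‖K t t - K s t - (K t s - K s s)‖ := by
    have a : Continuous fun t => K t t := hK.comp (by fun_prop : Continuous fun t => (t, t))
    have b : Continuous fun t => K s t := hK.comp (by fun_prop : Continuous fun t => (s, t))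
    have c : Continuous fun t => K t s := hK.comp (by fun_prop : Continuous fun t => (t, s))
    fun_prop
  simpa using h3.tendsto s

omit [TopologicalSpace X] in
theorem hsSq_featureMap (hV : ∀ s t, K s t = ContinuousLinearMap.adjoint (V t) ∘L V s) (t : X) :
    hsSq (consBasis H) (V t) =
      ∑' i, ENNReal.ofReal ⟪K t t (consBasis H i), consBasis H i⟫_ℝ := by
  refine tsum_congr fun i => ?_
  rw [hV, ContinuousLinearMap.comp_apply, ContinuousLinearMap.adjoint_inner_left,
    real_inner_self_eq_norm_sq]

omit [TopologicalSpace X] in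
theorem hsSq_featureMap_lt_top (hV : ∀ s t, K s t = ContinuousLinearMap.adjoint (V t) ∘L V s)
    (hK : ∀ s t, IsTraceClass (K s t)) (t : X) : hsSq (consBasis H) (V t) < ∞ := by
  rw [hsSq_featureMap hV]
  exact ((ENNReal.tsum_le_tsum fun i => ENNReal.ofReal_le_ofReal (le_abs_self _)).trans
    (tsum_abs_inner_le_traceNorm (K t t))).trans_lt (hK t t)

theorem tsum_ofReal_inner_le {A B D : H →L[ℝ] H}
    (h : ∀ x, ⟪A x, x⟫_ℝ ≤ ⟪B x, x⟫_ℝ + |⟪D x, x⟫_ℝ|) :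
    ∑' i, ENNReal.ofReal ⟪A (consBasis H i), consBasis H i⟫_ℝ ≤
      ∑' i, ENNReal.ofReal ⟪B (consBasis H i), consBasis H i⟫_ℝ + traceNorm D := by
  refine le_trans ?_ (add_le_add le_rfl (tsum_abs_inner_le_traceNorm D))
  rw [← ENNReal.tsum_add]
  exact ENNReal.tsum_le_tsum fun i =>
    (ENNReal.ofReal_le_ofReal (h _)).trans ENNReal.ofReal_add_le

/-- The function is t ↦ tr K(t,t), and traces differ by at most the trace norm of the difference. It
is the limit function in Dini's theorem, where operator-norm continuity would not suffice. -/
theorem continuous_hsSq_featureMap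
    (hV : ∀ s t, K s t = ContinuousLinearMap.adjoint (V t) ∘L V s)
    (hK : ∀ s t, IsTraceClass (K s t)) (hc : IsTraceContinuous K) :
    Continuous fun t => hsSq (consBasis H) (V t) := by
  refine continuous_iff_continuousAt.mpr fun s => ?_
  have h1 : ∀ t, (hsSq (consBasis H) (V t) ≤ hsSq (consBasis H) (V s) + traceNorm (K s s - K t t))
      ∧ hsSq (consBasis H) (V s) ≤ hsSq (consBasis H) (V t) + traceNorm (K s s - K t t) := by
    intro t
    rw [hsSq_featureMap hV, hsSq_featureMap hV]
    have h (x : H) : ⟪(K s s - K t t) x, x⟫_ℝ = ⟪K s s x, x⟫_ℝ - ⟪K t t x, x⟫_ℝ := by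
      rw [FunLike.coe_sub, Pi.sub_apply, inner_sub_left]
    refine ⟨tsum_ofReal_inner_le fun x => ?_, tsum_ofReal_inner_le fun x => ?_⟩
    · linarith [neg_abs_le ⟪(K s s - K t t) x, x⟫_ℝ, h x]
    · linarith [le_abs_self ⟪(K s s - K t t) x, x⟫_ℝ, h x]
  have h2 : Tendsto (fun t => traceNorm (K s s - K t t)) (𝓝 s) (𝓝 0) := by
    have hd : Tendsto (fun t : X => (t, t)) (𝓝 s) (𝓝 (s, s)) :=
      (continuous_id.prodMk continuous_id).tendsto s
    have hcs := hc s s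
    have hcomp := hcs.comp hd
    simpa only [Function.comp_def] using hcomp
  rw [ContinuousAt, ENNReal.tendsto_nhds (hsSq_featureMap_lt_top hV hK s).ne]
  intro ε hε
  filter_upwards [ENNReal.tendsto_nhds_zero.mp h2 ε hε] with t ht
  exact ⟨tsub_le_iff_right.mpr ((h1 t).2.trans (by gcongr)), (h1 t).1.trans (by gcongr)⟩

end Continuity

/-! ### The embedding J of the feature space into L² -/

section Embedding

variable {X H W : Type*} [TopologicalSpace X] [CompactSpace X]
  [NormedAddCommGroup H] [InnerProductSpace ℝ H]
  [CompleteSpace H] [NormedAddCommGroup W] [InnerProductSpace ℝ W] [CompleteSpace W]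

/-- The map `w ↦ (t ↦ V(t)* w)` into continuous functions. -/
noncomputable def evalMap (V : C(X, H →L[ℝ] W)) : W →L[ℝ] C(X, H) :=
  LinearMap.mkContinuous
    { toFun := fun w => ⟨fun t => ContinuousLinearMap.adjoint (V t) w, by fun_prop⟩
      map_add' := fun w w' => by ext t; simp
      map_smul' := fun c w => by ext t; simp } ‖V‖ fun w => by
    refine (ContinuousMap.norm_le _ (by positivity)).mpr fun t => ?_
    refine (ContinuousLinearMap.le_opNorm _ w).trans ?_
    rw [LinearIsometryEquiv.norm_map]
    gcongr
    exact V.norm_coe_le_norm t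

theorem evalMap_apply (V : C(X, H →L[ℝ] W)) (w : W) (t : X) :
    evalMap V w t = ContinuousLinearMap.adjoint (V t) w := rfl

variable [SecondCountableTopology X] [MeasurableSpace X] [BorelSpace X]
  (μ : Measure X) [IsFiniteMeasure μ]

/-- The map `w ↦ (t ↦ V(t)* w)` into `L²(μ, H)`. -/
noncomputable def embed (V : C(X, H →L[ℝ] W)) : W →L[ℝ] Lp H 2 μ :=
  ContinuousMap.toLp 2 μ ℝ ∘L evalMap V

variable {μ} (V : C(X, H →L[ℝ] W))

theorem embed_ae (w : W) : embed μ V w =ᵐ[μ] fun t => ContinuousLinearMap.adjoint (V t) w :=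
  ContinuousMap.coeFn_toLp μ (evalMap V w)

/-- A continuous function vanishing almost everywhere vanishes everywhere, since the measure has
full support. -/
theorem eq_zero_of_embed_eq_zero [μ.IsOpenPosMeasure] {w : W} (hw : embed μ V w = 0) (t : X) :
    ContinuousLinearMap.adjoint (V t) w = 0 := by
  have h : evalMap V w = 0 :=
    ContinuousMap.toLp_injective (p := 2) (𝕜 := ℝ) μ (by rw [map_zero]; exact hw)
  rw [← evalMap_apply, h, ContinuousMap.zero_apply]

theorem inner_embed_left (w : W) (f : Lp H 2 μ) :
    ⟪embed μ V w, f⟫_ℝ = ∫ t, ⟪ContinuousLinearMap.adjoint (V t) w, f t⟫_ℝ ∂μ := by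
  rw [L2.inner_def]
  refine integral_congr_ae ?_
  filter_upwards [embed_ae V w] with t ht
  rw [ht]

theorem ofReal_norm_embed_sq (w : W) :
    ENNReal.ofReal (‖embed μ V w‖ ^ 2) =
      ∫⁻ t, ENNReal.ofReal (‖ContinuousLinearMap.adjoint (V t) w‖ ^ 2) ∂μ := by
  rw [← real_inner_self_eq_norm_sq, L2.inner_def,
    ofReal_integral_eq_lintegral_ofReal (L2.integrable_inner _ _)
      (Eventually.of_forall fun t => real_inner_self_nonneg)]
  refine lintegral_congr_ae ?_
  filter_upwards [embed_ae V w] with t ht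
  rw [ht, real_inner_self_eq_norm_sq]

/-- J is Hilbert–Schmidt: by Tonelli its squared norm is ∫ ‖V(t)*‖²_HS dμ, at most C μ(X). -/
theorem isCompactOperator_embed {ι : Type*} (e : HilbertBasis ι ℝ H) {C : ℝ≥0∞} (hC : C < ∞)
    (hV : ∀ t, hsSq e (V t) ≤ C) : IsCompactOperator (embed μ V) := by
  obtain ⟨w, b, -⟩ := exists_hilbertBasis ℝ W
  refine isCompactOperator_of_hsSq_ne_top b _ (ne_top_of_le_ne_top
    (ENNReal.mul_lt_top hC (measure_lt_top μ Set.univ)).ne (b := C * μ Set.univ) ?_)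
  -- Finite partial sums commute with the integral even if the basis of W is uncountable.
  rw [hsSq, ENNReal.tsum_eq_iSup_sum]
  refine iSup_le fun F => ?_
  simp_rw [ofReal_norm_embed_sq]
  rw [← lintegral_finsetSum]
  · calc _ ≤ ∫⁻ _, C ∂μ := by
          refine lintegral_mono fun t => ?_
          refine (ENNReal.sum_le_tsum F).trans ?_
          refine le_trans (le_of_eq ?_) (hV t)
          exact (hsSq_eq_hsSq_adjoint e b (V t)).symm
      _ = _ := lintegral_const C
  · intro i _
    exact (ENNReal.continuous_ofReal.comp
      (((evalMap V (b i)).continuous.norm).pow 2)).measurable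

variable {K : X → X → H →L[ℝ] H}

theorem integrable_kernel_apply
    (hV : ∀ s t, K s t = ContinuousLinearMap.adjoint (V t) ∘L V s) (f : Lp H 2 μ) (t : X) :
    Integrable (fun s => K s t (f s)) μ := by
  have hf : Integrable f μ := (Lp.memLp f).integrable one_le_two
  have hV1 : AEStronglyMeasurable (fun s => V s (f s)) μ :=
    (ContinuousLinearMap.id ℝ (H →L[ℝ] W)).aestronglyMeasurable_comp₂
      V.continuous.aestronglyMeasurable hf.aestronglyMeasurable
  have hV2 : Integrable (fun s => V s (f s)) μ := by
    refine (hf.norm.const_mul ‖V‖).mono' hV1 (Eventually.of_forall fun s => ?_)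
    exact (V s).le_of_opNorm_le (V.norm_coe_le_norm s) _
  simp_rw [hV]
  exact (ContinuousLinearMap.adjoint (V t)).integrable_comp hV2

/-- The identity A_K = J J*, valid at every point t and not only almost everywhere. -/
theorem integralOperator_eq (hV : ∀ s t, K s t = ContinuousLinearMap.adjoint (V t) ∘L V s)
    (f : Lp H 2 μ) (t : X) :
    integralOperator μ K f t =
      ContinuousLinearMap.adjoint (V t) (ContinuousLinearMap.adjoint (embed μ V) f) := by
  refine ext_inner_left ℝ fun h => ?_
  rw [ContinuousLinearMap.adjoint_inner_right, ContinuousLinearMap.adjoint_inner_right,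
    inner_embed_left, integralOperator, ← integral_inner (integrable_kernel_apply V hV f t)]
  refine integral_congr_ae (Eventually.of_forall fun s => ?_)
  simp only [hV, ContinuousLinearMap.comp_apply]
  rw [ContinuousLinearMap.adjoint_inner_right, ContinuousLinearMap.adjoint_inner_left]

theorem isEigenEq_iff (hV : ∀ s t, K s t = ContinuousLinearMap.adjoint (V t) ∘L V s)
    (c : ℝ) (f : Lp H 2 μ) :
    IsEigenEq μ K c f ↔ embed μ V (ContinuousLinearMap.adjoint (embed μ V) f) = c • f := by
  have h1 : integralOperator μ K f =ᵐ[μ]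
      embed μ V (ContinuousLinearMap.adjoint (embed μ V) f) := by
    filter_upwards [embed_ae V (ContinuousLinearMap.adjoint (embed μ V) f)] with t ht
    rw [ht, integralOperator_eq V hV f t]
  have h2 : (c • f : Lp H 2 μ) =ᵐ[μ] fun t => c • f t := Lp.coeFn_smul c f
  rw [Lp.ext_iff]
  exact ⟨fun h => h1.symm.trans (h.trans h2.symm), fun h => h1.trans (h.trans h2)⟩

end Embedding

/-! ### Rank-one operators and compression by a projection -/

section Projection

variable {H W : Type*} [NormedAddCommGroup H] [InnerProductSpace ℝ H] [CompleteSpace H]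
  [NormedAddCommGroup W] [InnerProductSpace ℝ W] [CompleteSpace W]

omit [CompleteSpace H] in
theorem tensor_apply (u v h : H) : tensor u v h = ⟪u, h⟫_ℝ • v := by
  simp [tensor]

theorem adjoint_tensor_self (u : H) :
    ContinuousLinearMap.adjoint (tensor u u) = tensor u u := by
  ext x
  refine ext_inner_right ℝ fun y => ?_
  rw [ContinuousLinearMap.adjoint_inner_left, tensor_apply, tensor_apply, inner_smul_right,
    real_inner_smul_left, real_inner_comm x u, mul_comm]

/-- The factorization `V₂* D V₁` through a self-adjoint idempotent has trace norm bounded by the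
squared Hilbert–Schmidt norms of `V₁* D` and `V₂* D`. -/
theorem traceNorm_adjoint_comp_projection_le {κ : Type*} (ψ : HilbertBasis κ ℝ W)
    {D : W →L[ℝ] W} (hD : ContinuousLinearMap.adjoint D = D) (hDD : D ∘L D = D)
    (V₁ V₂ : H →L[ℝ] W) :
    traceNorm (ContinuousLinearMap.adjoint V₂ ∘L D ∘L V₁) ≤
      hsSq ψ (ContinuousLinearMap.adjoint V₁ ∘L D) +
        hsSq ψ (ContinuousLinearMap.adjoint V₂ ∘L D) := by
  have h1 : ∀ V : H →L[ℝ] W, hsSq ψ (ContinuousLinearMap.adjoint V ∘L D) =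
      hsSq (consBasis H) (D ∘L V) := fun V => by
    rw [hsSq_eq_hsSq_adjoint (consBasis H) ψ, ContinuousLinearMap.adjoint_comp, hD]
  have h2 : ContinuousLinearMap.adjoint V₂ ∘L D ∘L V₁ =
      ContinuousLinearMap.adjoint (D ∘L V₂) ∘L (D ∘L V₁) := by
    rw [ContinuousLinearMap.adjoint_comp, hD, ContinuousLinearMap.comp_assoc,
      ← ContinuousLinearMap.comp_assoc D D V₁, hDD]
  rw [h1, h1, h2]
  exact traceNorm_adjoint_comp_le _ _

end Projection

/-! ### Dini's theorem for tails -/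

section Dini

variable {X ι : Type*} [TopologicalSpace X] [CompactSpace X]

/-- Dini's theorem for a series of nonnegative continuous functions with continuous sum: the tails
tend to zero uniformly. -/
theorem tendsto_iSup_tsum_compl {a : ι → X → ℝ} (ha : ∀ j, Continuous (a j))
    (h0 : ∀ j t, 0 ≤ a j t) {τ : X → ℝ≥0∞} (hτ : Continuous τ) (hfin : ∀ t, τ t < ∞)
    (hsum : ∀ t, ∑' j, ENNReal.ofReal (a j t) = τ t) :
    Tendsto (fun F : Finset ι => ⨆ t, ∑' j : {j // j ∉ F}, ENNReal.ofReal (a j t))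
      atTop (𝓝 0) := by
  have hsm : ∀ t, HasSum (fun j => a j t) (τ t).toReal := fun t => by
    have hs : Summable fun j => a j t :=
      (ENNReal.summable_toReal ((hsum t).trans_lt (hfin t)).ne).congr fun j =>
        ENNReal.toReal_ofReal (h0 j t)
    have := hs.hasSum
    rwa [← ENNReal.toReal_ofReal (tsum_nonneg fun j => h0 j t),
      ENNReal.ofReal_tsum_of_nonneg (fun j => h0 j t) hs, hsum t] at this
  have htail : ∀ (F : Finset ι) t, ∑' j : {j // j ∉ F}, ENNReal.ofReal (a j t) =
      ENNReal.ofReal ((τ t).toReal - ∑ j ∈ F, a j t) := fun F t => by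
    have h1 := (hsm t).summable.sum_add_tsum_subtype_compl F
    rw [(hsm t).tsum_eq] at h1
    have h2 : Summable fun j : {j // j ∉ F} => a j t :=
      (hsm t).summable.comp_injective Subtype.val_injective
    rw [← h1, add_sub_cancel_left, ENNReal.ofReal_tsum_of_nonneg (fun _ => h0 _ t) h2]
  have hdini : TendstoUniformly (fun (F : Finset ι) t => ∑ j ∈ F, a j t)
      (fun t => (τ t).toReal) atTop :=
    Monotone.tendstoUniformly_of_forall_tendsto
      (fun F => continuous_finsetSum F fun j _ => ha j)
      (fun F G hFG t => Finset.sum_le_sum_of_subset_of_nonneg hFG fun j _ _ => h0 j t)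
      (continuous_iff_continuousAt.mpr fun t =>
        (ENNReal.tendsto_toReal (hfin t).ne).comp hτ.continuousAt)
      hsm
  rw [ENNReal.tendsto_nhds_zero]
  intro ε hε
  obtain ⟨δ, hδ, hδε⟩ := ENNReal.lt_iff_exists_nnreal_btwn.mp hε
  have hδ' : (0 : ℝ) < δ := by exact_mod_cast hδ
  filter_upwards [Metric.tendstoUniformly_iff.mp hdini δ hδ'] with F hF
  refine iSup_le fun t => ?_
  rw [htail]
  refine le_trans (ENNReal.ofReal_le_ofReal ((le_abs_self _).trans (hF t).le)) ?_
  rw [ENNReal.ofReal_coe_nnreal]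
  exact hδε.le

end Dini

/-! ### Eigenfunctions, feature vectors and the expansion -/

section Eigensystem

variable {X H W ι : Type*} [TopologicalSpace X] [CompactSpace X]
  [SecondCountableTopology X] [MeasurableSpace X] [BorelSpace X]
  {μ : Measure X} [IsFiniteMeasure μ]
  [NormedAddCommGroup H] [InnerProductSpace ℝ H] [CompleteSpace H]
  [NormedAddCommGroup W] [InnerProductSpace ℝ W] [CompleteSpace W]
  {K : X → X → H →L[ℝ] H} (V : C(X, H →L[ℝ] W))
  {lam : ι → ℝ} {Φ : ι → Lp H 2 μ}

/-- Moving J across leaves ⟪Φ_i, J J*Φ_j⟫. Thus J* maps the eigenfunctions to orthogonal vectors of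
squared norm λ_j. -/
theorem inner_adjoint_embed_eigen
    (hV : ∀ s t, K s t = ContinuousLinearMap.adjoint (V t) ∘L V s)
    (hΦ : IsEigensystem μ K lam Φ) (i j : ι) :
    ⟪ContinuousLinearMap.adjoint (embed μ V) (Φ i),
      ContinuousLinearMap.adjoint (embed μ V) (Φ j)⟫_ℝ = lam j * ⟪Φ i, Φ j⟫_ℝ := by
  rw [ContinuousLinearMap.adjoint_inner_left, (isEigenEq_iff V hV _ _).mp (hΦ.eigen j),
    inner_smul_right]

theorem IsEigensystem.nonneg
    (hV : ∀ s t, K s t = ContinuousLinearMap.adjoint (V t) ∘L V s)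
    (hΦ : IsEigensystem μ K lam Φ) (j : ι) : 0 ≤ lam j := by
  have h := inner_adjoint_embed_eigen V hV hΦ j j
  rw [real_inner_self_eq_norm_sq, real_inner_self_eq_norm_sq, hΦ.orthonormal.1 j] at h
  nlinarith [sq_nonneg ‖ContinuousLinearMap.adjoint (embed μ V) (Φ j)‖]

/-- The images of the eigenfunctions in the feature space, normalized. -/
noncomputable def featureVector (μ : Measure X) [IsFiniteMeasure μ] (V : C(X, H →L[ℝ] W))
    (lam : ι → ℝ) (Φ : ι → Lp H 2 μ) (j : {j // lam j ≠ 0}) : W :=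
  (√(lam j))⁻¹ • ContinuousLinearMap.adjoint (embed μ V) (Φ j)

theorem orthonormal_featureVector
    (hV : ∀ s t, K s t = ContinuousLinearMap.adjoint (V t) ∘L V s)
    (hΦ : IsEigensystem μ K lam Φ) : Orthonormal ℝ (featureVector μ V lam Φ) := by
  classical
  rw [orthonormal_iff_ite]
  intro i j
  rw [featureVector, featureVector, real_inner_smul_left, inner_smul_right,
    inner_adjoint_embed_eigen V hV hΦ, orthonormal_iff_ite.mp hΦ.orthonormal i j]
  split_ifs with h1 h2 h2
  · subst h2
    have hpos : 0 < lam i := lt_of_le_of_ne (hΦ.nonneg V hV i) i.2.symm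
    have hs : √(lam i) ≠ 0 := (Real.sqrt_pos.mpr hpos).ne'
    field_simp
    rw [Real.sq_sqrt hpos.le]
  · exact absurd (Subtype.ext h1) h2
  · exact absurd (congrArg _ h2) h1
  · simp

/-- The normalized feature vectors are complete in the feature space. -/
theorem span_featureVector_orthogonal_eq_bot [μ.IsOpenPosMeasure]
    (hV : ∀ s t, K s t = ContinuousLinearMap.adjoint (V t) ∘L V s)
    (hdense : ∀ w, (∀ t, ContinuousLinearMap.adjoint (V t) w = 0) → w = 0)
    (hcomp : IsCompactOperator (embed μ V)) (hΦ : IsEigensystem μ K lam Φ) :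
    (Submodule.span ℝ (Set.range (featureVector μ V lam Φ)))ᗮ = ⊥ := by
  rw [Submodule.eq_bot_iff]
  intro w hw
  refine hdense w (eq_zero_of_embed_eq_zero (μ := μ) V ?_)
  set J := embed μ V with hJ
  set A : Lp H 2 μ →L[ℝ] Lp H 2 μ := J ∘L ContinuousLinearMap.adjoint J with hA
  have hAc : IsCompactOperator A := hcomp.comp_clm (ContinuousLinearMap.adjoint J)
  have hAs : A.IsSymmetric := fun f g => by
    simp only [hA, ContinuousLinearMap.coe_coe, ContinuousLinearMap.comp_apply]
    rw [← ContinuousLinearMap.adjoint_inner_right, ContinuousLinearMap.adjoint_inner_left]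
  have hbot := ContinuousLinearMap.orthogonalComplement_iSup_eigenspaces_eq_bot hAc hAs
  have hΦw : ∀ j, lam j ≠ 0 → ⟪J w, Φ j⟫_ℝ = 0 := fun j hj => by
    have h1 := (Submodule.mem_orthogonal _ _).mp hw (featureVector μ V lam Φ ⟨j, hj⟩)
      (Submodule.subset_span ⟨_, rfl⟩)
    have hpos : 0 < lam j := lt_of_le_of_ne (hΦ.nonneg V hV j) hj.symm
    rw [featureVector, real_inner_smul_left, mul_eq_zero, inv_eq_zero,
      or_iff_right (Real.sqrt_pos.mpr hpos).ne'] at h1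
    rw [← ContinuousLinearMap.adjoint_inner_right, real_inner_comm, h1]
  -- J w is orthogonal to every eigenspace of J J*: to the kernel because J J* f = 0 forces J* f =
  -- 0, and to the others because the Φ_j exhaust them.
  have hmem : J w ∈ (⨆ c, Module.End.eigenspace (A : Lp H 2 μ →ₗ[ℝ] Lp H 2 μ) c)ᗮ := by
    rw [← Submodule.iInf_orthogonal, Submodule.mem_iInf]
    intro c
    rw [Submodule.mem_orthogonal']
    intro f hf
    have hf' : J (ContinuousLinearMap.adjoint J f) = c • f :=
      Module.End.mem_eigenspace_iff.mp hf
    rcases eq_or_ne c 0 with rfl | hc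
    · have h0 : ContinuousLinearMap.adjoint J f = 0 := by
        rw [← norm_eq_zero, ← sq_eq_zero_iff, ← real_inner_self_eq_norm_sq,
          ContinuousLinearMap.adjoint_inner_left, hf', zero_smul, inner_zero_right]
      rw [← ContinuousLinearMap.adjoint_inner_right, h0, inner_zero_right]
    · have hcl := hΦ.exhaust c hc f ((isEigenEq_iff V hV c f).mpr hf')
      have hle : (Submodule.span ℝ (Φ '' {j | lam j = c})).topologicalClosure ≤
          (Submodule.span ℝ {J w})ᗮ := by
        refine Submodule.topologicalClosure_minimal _ ?_ (Submodule.isClosed_orthogonal _)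
        rw [Submodule.span_le]
        rintro _ ⟨j, rfl, rfl⟩
        exact Submodule.mem_orthogonal_singleton_iff_inner_right.mpr (hΦw j hc)
      exact Submodule.mem_orthogonal_singleton_iff_inner_right.mp (hle hcl)
  rw [hbot] at hmem
  exact (Submodule.mem_bot ℝ).mp hmem

/-- The pointwise defined eigenfunctions: the continuous version where the eigenvalue is nonzero,
an arbitrary representative otherwise. -/
noncomputable def eigenfunction (μ : Measure X) [IsFiniteMeasure μ] (V : C(X, H →L[ℝ] W))
    (lam : ι → ℝ) (Φ : ι → Lp H 2 μ) (j : ι) (t : X) : H :=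
  open Classical in
  if lam j = 0 then Φ j t
  else (lam j)⁻¹ •
    ContinuousLinearMap.adjoint (V t) (ContinuousLinearMap.adjoint (embed μ V) (Φ j))

theorem eigenfunction_of_ne {j : ι} (hj : lam j ≠ 0) (t : X) :
    eigenfunction μ V lam Φ j t = (lam j)⁻¹ •
      ContinuousLinearMap.adjoint (V t) (ContinuousLinearMap.adjoint (embed μ V) (Φ j)) :=
  if_neg hj

theorem eigenfunction_ae (hV : ∀ s t, K s t = ContinuousLinearMap.adjoint (V t) ∘L V s)
    (hΦ : IsEigensystem μ K lam Φ) (j : ι) : eigenfunction μ V lam Φ j =ᵐ[μ] Φ j := by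
  by_cases hj : lam j = 0
  · exact Eventually.of_forall fun t => if_pos hj
  · filter_upwards [hΦ.eigen j] with t ht
    rw [eigenfunction_of_ne V hj, ← integralOperator_eq V hV, ht, inv_smul_smul₀ hj]

theorem continuous_eigenfunction {j : ι} (hj : lam j ≠ 0) :
    Continuous (eigenfunction μ V lam Φ j) := by
  have h : eigenfunction μ V lam Φ j = fun t => (lam j)⁻¹ •
      evalMap V (ContinuousLinearMap.adjoint (embed μ V) (Φ j)) t :=
    funext fun t => eigenfunction_of_ne V hj t
  rw [h]
  fun_prop

/-- This is V(t)* ψ_j = √λ_j φ_j(t) in norm; it turns Parseval in W into the diagonal Mercer series.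
-/
theorem norm_adjoint_featureVector_sq
    (hV : ∀ s t, K s t = ContinuousLinearMap.adjoint (V t) ∘L V s)
    (hΦ : IsEigensystem μ K lam Φ) (j : {j // lam j ≠ 0}) (t : X) :
    ‖ContinuousLinearMap.adjoint (V t) (featureVector μ V lam Φ j)‖ ^ 2 =
      lam j * ‖eigenfunction μ V lam Φ j t‖ ^ 2 := by
  have hpos : 0 < lam j := lt_of_le_of_ne (hΦ.nonneg V hV j) j.2.symm
  rw [eigenfunction_of_ne V j.2, featureVector, map_smul, norm_smul, norm_smul, mul_pow, mul_pow,
    norm_inv, norm_inv, Real.norm_of_nonneg (Real.sqrt_nonneg _), Real.norm_of_nonneg hpos.le,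
    inv_pow, Real.sq_sqrt hpos.le]
  field_simp

/-- The projection onto the complement of the feature vectors with indices in `F`. -/
noncomputable def remainderProjection (μ : Measure X) [IsFiniteMeasure μ] (V : C(X, H →L[ℝ] W))
    (lam : ι → ℝ) (Φ : ι → Lp H 2 μ) (F : Finset ι) : W →L[ℝ] W :=
  -- Indices with `lam j = 0` contribute nothing, by the convention 0⁻¹ = 0.
  ContinuousLinearMap.id ℝ W - ∑ j ∈ F, (lam j)⁻¹ •
    tensor (ContinuousLinearMap.adjoint (embed μ V) (Φ j))
      (ContinuousLinearMap.adjoint (embed μ V) (Φ j))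

theorem adjoint_remainderProjection (F : Finset ι) :
    ContinuousLinearMap.adjoint (remainderProjection μ V lam Φ F) =
      remainderProjection μ V lam Φ F := by
  simp only [remainderProjection, map_sub, map_sum, map_smul, adjoint_tensor_self,
    ContinuousLinearMap.adjoint_id]

theorem remainderProjection_apply_featureVector [DecidableEq ι]
    (hV : ∀ s t, K s t = ContinuousLinearMap.adjoint (V t) ∘L V s)
    (hΦ : IsEigensystem μ K lam Φ) (F : Finset ι) (j : {j // lam j ≠ 0}) :
    remainderProjection μ V lam Φ F (featureVector μ V lam Φ j) =
      if j.1 ∈ F then 0 else featureVector μ V lam Φ j := by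
  have h1 : ∀ i ∈ F, ((lam i)⁻¹ • tensor (ContinuousLinearMap.adjoint (embed μ V) (Φ i))
      (ContinuousLinearMap.adjoint (embed μ V) (Φ i))) (featureVector μ V lam Φ j) =
      if i = j.1 then featureVector μ V lam Φ j else 0 := fun i _ => by
    rw [FunLike.coe_smul, Pi.smul_apply, tensor_apply, featureVector, inner_smul_right,
      inner_adjoint_embed_eigen V hV hΦ, orthonormal_iff_ite.mp hΦ.orthonormal i j]
    split_ifs with h
    · rw [h, mul_one, smul_smul]
      congr 1
      field_simp [j.2]
    · simp
  rw [remainderProjection, FunLike.coe_sub, Pi.sub_apply, FunLike.coe_sum,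
    Finset.sum_apply, Finset.sum_congr rfl h1, Finset.sum_ite_eq']
  split_ifs <;> simp

/-- Each Mercer term is V(t)* P_j V(s), where P_j = λ_j⁻¹ J*Φ_j ⊗ J*Φ_j. -/
theorem kernel_sub_sum_eq
    (hV : ∀ s t, K s t = ContinuousLinearMap.adjoint (V t) ∘L V s) (F : Finset ι) (s t : X) :
    K s t - ∑ j ∈ F, lam j • tensor (eigenfunction μ V lam Φ j s) (eigenfunction μ V lam Φ j t) =
      ContinuousLinearMap.adjoint (V t) ∘L remainderProjection μ V lam Φ F ∘L V s := by
  ext h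
  simp only [remainderProjection, FunLike.coe_sub, Pi.sub_apply, FunLike.coe_sum,
    Finset.sum_apply, ContinuousLinearMap.comp_apply, ContinuousLinearMap.id_apply, map_sub,
    map_sum, hV s t]
  congr 1
  refine Finset.sum_congr rfl fun j _ => ?_
  rw [FunLike.coe_smul, Pi.smul_apply, FunLike.coe_smul, Pi.smul_apply, tensor_apply,
    tensor_apply]
  rcases eq_or_ne (lam j) 0 with hj | hj
  · simp [hj]
  · rw [eigenfunction_of_ne V hj, eigenfunction_of_ne V hj, real_inner_smul_left,
      ContinuousLinearMap.adjoint_inner_left, map_smul, map_smul, smul_smul, smul_smul, smul_smul]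
    congr 1
    field_simp

variable [μ.IsOpenPosMeasure]

/-- **Mercer's theorem** for a kernel given by a continuous feature map. -/
theorem mercer_of_featureMap
    (hV : ∀ s t, K s t = ContinuousLinearMap.adjoint (V t) ∘L V s)
    (hdense : ∀ w, (∀ t, ContinuousLinearMap.adjoint (V t) w = 0) → w = 0)
    (hK : ∀ s t, IsTraceClass (K s t)) (hc : IsTraceContinuous K)
    (hΦ : IsEigensystem μ K lam Φ) :
    ∃ φ : ι → X → H, (∀ j, φ j =ᵐ[μ] Φ j) ∧ (∀ j, lam j ≠ 0 → Continuous (φ j)) ∧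
      (∀ s t : X, ∑' j, traceNorm (lam j • tensor (φ j s) (φ j t)) < ∞) ∧
      Tendsto (fun F : Finset ι => ⨆ (s : X) (t : X), ∑' j : {j // j ∉ F},
          traceNorm (lam j • tensor (φ j s) (φ j t))) atTop (𝓝 0) ∧
      Tendsto (fun F : Finset ι => ⨆ (s : X) (t : X),
          traceNorm (K s t - ∑ j ∈ F, lam j • tensor (φ j s) (φ j t))) atTop (𝓝 0) := by
  classical
  have hτ := continuous_hsSq_featureMap hV hK hc
  have hfin := hsSq_featureMap_lt_top hV hK
  have hcomp : IsCompactOperator (embed μ V) := by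
    refine isCompactOperator_embed (C := ⨆ t, hsSq (consBasis H) (V t)) V (consBasis H) ?_
      fun t => le_iSup (fun t => hsSq (consBasis H) (V t)) t
    rcases isEmpty_or_nonempty X with _ | _
    · simp
    · obtain ⟨t, ht⟩ := hτ.exists_forall_ge'
        (x₀ := Classical.arbitrary X) (by simp)
      exact (iSup_le ht).trans_lt (hfin t)
  have horth := orthonormal_featureVector V hV hΦ
  set ψ := HilbertBasis.mkOfOrthogonalEqBot horth
    (span_featureVector_orthogonal_eq_bot V hV hdense hcomp hΦ) with hψ
  have hψc : ∀ j, ψ j = featureVector μ V lam Φ j := fun j => by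
    rw [hψ, HilbertBasis.coe_mkOfOrthogonalEqBot]
  set φ := eigenfunction μ V lam Φ with hφ
  set a : ι → X → ℝ := fun j t => lam j * ‖φ j t‖ ^ 2 with ha
  have h0 : ∀ j t, 0 ≤ a j t := fun j t => mul_nonneg (hΦ.nonneg V hV j) (sq_nonneg _)
  have hac : ∀ j, Continuous (a j) := fun j => by
    rcases eq_or_ne (lam j) 0 with hj | hj
    · simp only [ha, hj, zero_mul]
      exact continuous_const
    · exact continuous_const.mul ((continuous_eigenfunction V hj).norm.pow 2)
  set D := remainderProjection μ V lam Φ with hD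
  have hDψ : ∀ F j, D F (ψ j) = if j.1 ∈ F then 0 else ψ j := fun F j => by
    rw [hψc]; exact remainderProjection_apply_featureVector V hV hΦ F j
  have hDD : ∀ F, D F ∘L D F = D F := fun F => by
    refine ContinuousLinearMap.ext_on (s := Set.range ψ)
      (Submodule.dense_iff_topologicalClosure_eq_top.mpr ψ.dense_span) ?_
    rintro _ ⟨j, rfl⟩
    rw [ContinuousLinearMap.comp_apply, hDψ]
    split_ifs with h
    · exact map_zero _
    · rw [hDψ, if_neg h]
  -- In the basis ψ, D_F keeps exactly the vectors with index outside F. Indices with λ_j = 0 are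
  -- missing from ψ, but their terms vanish.
  have htail : ∀ F t, hsSq ψ (ContinuousLinearMap.adjoint (V t) ∘L D F) =
      ∑' j : {j // j ∉ F}, ENNReal.ofReal (a j t) := fun F t => by
    have h1 : ∀ j : {j // lam j ≠ 0},
        ENNReal.ofReal (‖(ContinuousLinearMap.adjoint (V t) ∘L D F) (ψ j)‖ ^ 2) =
          {j | j ∉ F}.indicator (fun j => ENNReal.ofReal (a j t)) j.1 := fun j => by
      rw [ContinuousLinearMap.comp_apply, hDψ]
      by_cases hj : j.1 ∈ F
      · rw [if_pos hj, Set.indicator_of_notMem (by simpa using hj)]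
        simp
      · rw [if_neg hj, Set.indicator_of_mem (by simpa using hj), hψc,
          norm_adjoint_featureVector_sq V hV hΦ]
    rw [hsSq, tsum_congr h1]
    refine (tsum_subtype_eq_of_support_subset (s := {j | lam j ≠ 0})
      (f := {j | j ∉ F}.indicator fun j => ENNReal.ofReal (a j t)) ?_).trans ?_
    rotate_left
    · exact (tsum_subtype {j | j ∉ F} fun j => ENNReal.ofReal (a j t)).symm
    · intro j hj hj0
      refine hj ?_
      simp only [Set.indicator_apply, ha, hj0]
      simp
  -- The case F = ∅, where D_F is the identity: the diagonal series sums to tr K(t,t).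
  have hsum : ∀ t, ∑' j, ENNReal.ofReal (a j t) = hsSq (consBasis H) (V t) := fun t => by
    have h1 := htail ∅ t
    have h2 : D ∅ = ContinuousLinearMap.id ℝ W := by simp [hD, remainderProjection]
    rw [h2, ContinuousLinearMap.comp_id, ← hsSq_eq_hsSq_adjoint] at h1
    rw [h1]
    exact ((Equiv.subtypeUnivEquiv (p := fun j => j ∉ (∅ : Finset ι)) (by simp)).tsum_eq
      fun j => ENNReal.ofReal (a j t)).symm
  have hlim := tendsto_iSup_tsum_compl hac h0 hτ hfin hsum
  set R : Finset ι → ℝ≥0∞ := fun F => ⨆ t, ∑' j : {j // j ∉ F}, ENNReal.ofReal (a j t) with hR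
  have hlim2 : Tendsto (fun F => R F + R F) atTop (𝓝 0) := by simpa using hlim.add hlim
  have hterm : ∀ j s t, traceNorm (lam j • tensor (φ j s) (φ j t)) ≤
      ENNReal.ofReal (a j s) + ENNReal.ofReal (a j t) := fun j s t =>
    traceNorm_smul_tensor_le (hΦ.nonneg V hV j) _ _
  have hRle : ∀ F t, ∑' j : {j // j ∉ F}, ENNReal.ofReal (a j t) ≤ R F := fun F t =>
    le_iSup (fun t => ∑' j : {j // j ∉ F}, ENNReal.ofReal (a j t)) t
  refine ⟨φ, eigenfunction_ae V hV hΦ, fun j hj => continuous_eigenfunction V hj,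
    fun s t => ?_, ?_, ?_⟩
  · refine (ENNReal.tsum_le_tsum fun j => hterm j s t).trans_lt ?_
    rw [ENNReal.tsum_add, hsum, hsum]
    exact ENNReal.add_lt_top.mpr ⟨hfin s, hfin t⟩
  · refine tendsto_of_tendsto_of_tendsto_of_le_of_le tendsto_const_nhds hlim2
      (fun _ => zero_le) fun F => iSup₂_le fun s t => ?_
    refine (ENNReal.tsum_le_tsum fun j : {j // j ∉ F} => hterm j s t).trans ?_
    rw [ENNReal.tsum_add]
    exact add_le_add (hRle F s) (hRle F t)
  · refine tendsto_of_tendsto_of_tendsto_of_le_of_le tendsto_const_nhds hlim2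
      (fun _ => zero_le) fun F => iSup₂_le fun s t => ?_
    rw [kernel_sub_sum_eq V hV]
    refine (traceNorm_adjoint_comp_projection_le ψ (adjoint_remainderProjection V F) (hDD F)
      (V s) (V t)).trans ?_
    rw [htail, htail]
    exact add_le_add (hRle F s) (hRle F t)

end Eigensystem

/-! ### Lebesgue measure on a compact set -/

section Lebesgue

variable {d : ℕ} {T : Set (EuclideanSpace ℝ (Fin d))}

theorem lebesgueOn_apply (hT : MeasurableSet T) (U : Set T) :
    lebesgueOn T U = volume (Subtype.val '' U) :=
  (MeasurableEmbedding.subtype_coe hT).comap_apply _ _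

theorem isFiniteMeasure_lebesgueOn (hT : IsCompact T) : IsFiniteMeasure (lebesgueOn T) := by
  refine ⟨?_⟩
  rw [lebesgueOn_apply hT.measurableSet]
  exact (measure_mono (Subtype.coe_image_subset T _)).trans_lt hT.measure_lt_top

theorem isOpenPosMeasure_lebesgueOn (hT : MeasurableSet T)
    (hTpos : ∀ t ∈ T, ∀ r : ℝ, 0 < r → 0 < volume (T ∩ Metric.ball t r)) :
    (lebesgueOn T).IsOpenPosMeasure := by
  refine ⟨fun U hU hne => ?_⟩
  obtain ⟨t, ht⟩ := hne
  obtain ⟨r, hr, hball⟩ := Metric.isOpen_iff.mp hU t ht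
  rw [lebesgueOn_apply hT]
  refine ((hTpos t t.2 r hr).trans_le (measure_mono ?_)).ne'
  rintro x ⟨hxT, hx⟩
  exact ⟨⟨x, hxT⟩, hball hx, rfl⟩

end Lebesgue

end OperatorMercer

theorem theorem1 {d : ℕ} (T : Set (EuclideanSpace ℝ (Fin d))) (hT : IsCompact T)
    (hTpos : ∀ t ∈ T, ∀ r : ℝ, 0 < r → 0 < volume (T ∩ Metric.ball t r))
    {H : Type*} [NormedAddCommGroup H] [InnerProductSpace ℝ H] [CompleteSpace H]
    [TopologicalSpace.SeparableSpace H]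
    (K : T → T → H →L[ℝ] H)
    (hKtc : ∀ s t, OperatorMercer.IsTraceClass (K s t))
    (hKcont : OperatorMercer.IsTraceContinuous K)
    (hKsymm : OperatorMercer.IsSymmKernel K)
    (hKnonneg : OperatorMercer.IsNonnegDef K)
    {ι : Type*} (lam : ι → ℝ) (Φ : ι → Lp H 2 (OperatorMercer.lebesgueOn T))
    (hΦ : OperatorMercer.IsEigensystem (OperatorMercer.lebesgueOn T) K lam Φ) :
    -- the eigenfunctions with nonzero eigenvalue have continuous representatives, through
    -- which their point values are defined
    ∃ φ : ι → T → H, (∀ j, φ j =ᵐ[OperatorMercer.lebesgueOn T] Φ j) ∧ (∀ j, lam j ≠ 0 → Continuous (φ j)) ∧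
      -- the series converges absolutely in trace norm at every `(s, t)`
      (∀ s t : T,
        ∑' j, OperatorMercer.traceNorm (lam j • OperatorMercer.tensor (φ j s) (φ j t)) < ∞) ∧
      -- the series of trace norms converges uniformly
      Tendsto (fun F : Finset ι => ⨆ (s : T) (t : T), ∑' j : {j // j ∉ F},
          OperatorMercer.traceNorm (lam j • OperatorMercer.tensor (φ j s) (φ j t)))
        atTop (𝓝 0) ∧
      -- the series converges to `K`, uniformly in trace norm
      Tendsto (fun F : Finset ι => ⨆ (s : T) (t : T),
          OperatorMercer.traceNorm
            (K s t - ∑ j ∈ F, lam j • OperatorMercer.tensor (φ j s) (φ j t)))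
        atTop (𝓝 0) := by
  have : CompactSpace T := isCompact_iff_compactSpace.mp hT
  have := OperatorMercer.isFiniteMeasure_lebesgueOn hT
  have := OperatorMercer.isOpenPosMeasure_lebesgueOn hT.measurableSet hTpos
  obtain ⟨W, _, _, _, V, hV, hdense⟩ := OperatorMercer.exists_featureMap K hKsymm hKnonneg
  exact OperatorMercer.mercer_of_featureMap
    ⟨V, OperatorMercer.continuous_featureMap hKcont.continuous hV⟩ hV hdense hKtc hKcont hΦ
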